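/- Let $A$, $S$, $\Gamma$ be finite sets (input alphabet, states, stack alphabet). A nondeterministic pushdown automaton (NPDA) $P$ consists of an initial state $s^0\in S$, a set $S^{\mathrm{yes}}\subseteq S\times(\Gamma\cup\{\mathrm{empty}\})$ of accepting pairs, and a multi-valued transition function $$\delta : S\times(\Gamma\cup\{\mathrm{empty}\})\times(A\cup\{\varepsilon\})\to\wp\bigl(S\times(\{(\mathrm{push},\gamma)\mid\gamma\in\Gamma\}\cup\{\mathrm{pop},\ \mathrm{do\ nothing}\})\bigr).$$ In each step, $P$ is in a state $s$, sees $t$, the top symbol of the stack or the fact that the stack is empty, either reads the next input symbol $a$ or makes an $\varepsilon$-transition ($a=\varepsilon$) that reads nothing, chooses a pair in $\delta(s,t,a)$, moves to the new state and performs the action on the stack; a pop cannot be performed on the empty stack. (NPDAs without $\varepsilon$-transitions are the case $\delta(s,t,\varepsilon)=\emptyset$.) The language $L(P)\subseteq A^*$ recognized by $P$ is the set of words $w$ for which there is a finite computation path that starts in state $s^0$ with the empty stack, reads exactly $w$, and ends in a state $s$ with top of stack $t$ (a symbol or "empty") such that $(s,t)\in S^{\mathrm{yes}}$. Theorem. Every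 language recognized by an NPDA is context-free, i.e. it is generated by some context-free grammar. -/

import Mathlib

/-- The actions a push-down automaton can perform on its stack. -/
inductive StackAction (Γ : Type*) where
  | push (γ : Γ)
  | pop
  | doNothing

/-- The effect of an action on a stack, written with its top symbol first.
An empty stack cannot be popped: that action is not executable and gives `none`. -/
def StackAction.apply {Γ : Type*} : StackAction Γ → List Γ → Option (List Γ)
  | .push γ, st => some (γ :: st)
  | .pop, _ :: st => some st
  | .pop, [] => none
  | .doNothing, st => some st

/-- A nondeterministic push-down automaton with input alphabet `A`, states `S` and stack
alphabet `Γ`. What it sees of the stack is an element of `Option Γ`: the top symbol, or `none`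
if the stack is empty. The input of a transition is an element of `Option A`: a symbol that is
read, or `none` for an `ε`-transition. An automaton without `ε`-transitions is one with
`δ s t none = ∅` for all `s` and `t`. -/
structure NPDA (A S Γ : Type*) where
  /-- The multi-valued transition function. -/
  δ : S → Option Γ → Option A → Set (S × StackAction Γ)
  /-- The initial state. -/
  start : S
  /-- The accepting pairs of a state and the top of the stack (`none` for the empty stack). -/
  accept : Set (S × Option Γ)

namespace NPDA

/-- `P.Path s st w s' st'`: some computation path of `P` leads from state `s` with stack `st` to
state `s'` with stack `st'`, reading exactly the word `w` on the way. -/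
inductive Path {A S Γ : Type*} (P : NPDA A S Γ) :
    S → List Γ → List A → S → List Γ → Prop where
  | refl (s : S) (st : List Γ) : Path P s st [] s st
  | step {s₁ s₂ s₃ : S} {st₁ st₂ st₃ : List Γ} {a : Option A} {act : StackAction Γ} {w : List A}
      (htrans : (s₂, act) ∈ P.δ s₁ st₁.head? a) (hstack : act.apply st₁ = some st₂)
      (hrest : Path P s₂ st₂ w s₃ st₃) : Path P s₁ st₁ (a.toList ++ w) s₃ st₃

/-- The language recognized by `P`: the words `w` for which some computation path starts in the
initial state with the empty stack, reads all of `w`, and ends in an accepting situation. -/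
def language {A S Γ : Type*} (P : NPDA A S Γ) : Language A :=
  {w | ∃ (s : S) (st : List Γ), P.Path P.start [] w s st ∧ (s, st.head?) ∈ P.accept}

end NPDA

/-! The languages derived from the nonterminals of a grammar form the least family closed under its
rules. So it suffices to give finitely many rules, a closed family whose value at one nonterminal
lies in `P.language` (soundness), and a proof that every closed family contains `P.language` there
(completeness). No derivation is handled for the automaton itself.

The rules are a variant of the triple construction: a push is either matched with the pop that
removes its symbol, after which the same top `t` is visible again, or never undone. Soundness runs
computations above an arbitrary stack. Completeness goes backwards along a path, using `Cut` as the
invariant for nonempty stacks. -/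

/-- The language denoted by a symbol when the nonterminal `n` denotes the language `K n`. -/
def Symbol.languageUnder {T N : Type*} (K : N → Language T) : Symbol T N → Language T
  | .terminal a => {[a]}
  | .nonterminal n => K n

namespace ContextFreeRule

/-- The language denoted by a sentential form when the nonterminal `n` denotes `K n`. -/
def formLanguage {T N : Type*} (K : N → Language T) (u : List (Symbol T N)) : Language T :=
  (u.map (Symbol.languageUnder K)).prod

section formLanguage

variable {T N : Type*} (K : N → Language T)

@[simp] theorem formLanguage_nil : formLanguage K [] = 1 := rfl

@[simp] theorem formLanguage_cons (x : Symbol T N) (u : List (Symbol T N)) :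
    formLanguage K (x :: u) = x.languageUnder K * formLanguage K u := by
  simp [formLanguage]

@[simp] theorem formLanguage_append (u v : List (Symbol T N)) :
    formLanguage K (u ++ v) = formLanguage K u * formLanguage K v := by
  simp [formLanguage]

@[simp] theorem formLanguage_map_terminal (w : List T) :
    formLanguage K (w.map Symbol.terminal) = {w} := by
  induction w with
  | nil => rfl
  | cons a w ih =>
    rw [List.map_cons, formLanguage_cons, ih]
    ext x
    rw [Language.mem_mul]
    constructor
    · rintro ⟨_, rfl, _, rfl, rfl⟩
      rfl
    · rintro rfl
      exact ⟨[a], rfl, w, rfl, rfl⟩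

end formLanguage

/-- A family of languages is closed under a set of rules if the output of each rule denotes a
sublanguage of what its input denotes. -/
def IsClosedFamily {T N : Type*} (R : Set (ContextFreeRule T N)) (K : N → Language T) : Prop :=
  ∀ r ∈ R, formLanguage K r.output ≤ K r.input

theorem Rewrites.formLanguage_le {T N : Type*} {K : N → Language T} {r : ContextFreeRule T N}
    (hr : formLanguage K r.output ≤ K r.input) {u v : List (Symbol T N)}
    (huv : r.Rewrites u v) : formLanguage K v ≤ formLanguage K u := by
  induction huv with
  | head s =>
    rw [formLanguage_append, formLanguage_cons]
    exact mul_le_mul' hr le_rfl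
  | cons x _ ih =>
    rw [formLanguage_cons, formLanguage_cons]
    exact mul_le_mul' le_rfl ih

/-- Renaming the nonterminals of a rule. -/
def mapNonterminal {T N N' : Type*} (f : N → N') (r : ContextFreeRule T N) :
    ContextFreeRule T N' :=
  ⟨f r.input, r.output.map fun
    | .terminal a => .terminal a
    | .nonterminal n => .nonterminal (f n)⟩

theorem formLanguage_mapNonterminal {T N N' : Type*} (f : N → N') (r : ContextFreeRule T N)
    (K : N' → Language T) :
    formLanguage K (r.mapNonterminal f).output = formLanguage (K ∘ f) r.output := by
  simp only [formLanguage, mapNonterminal, List.map_map]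
  congr 2
  funext x
  cases x <;> rfl

end ContextFreeRule

/-! ### Grammars as least closed families -/

namespace ContextFreeGrammar

open ContextFreeRule

variable {T : Type*} (g : ContextFreeGrammar T)

/-- The words that can be derived from a nonterminal. -/
def languageFrom (n : g.NT) : Language T :=
  {w | g.Derives [Symbol.nonterminal n] (w.map Symbol.terminal)}

theorem derives_of_mem_formLanguage {u : List (Symbol T g.NT)} {w : List T}
    (hw : w ∈ formLanguage g.languageFrom u) : g.Derives u (w.map Symbol.terminal) := by
  induction u generalizing w with
  | nil =>
    rw [formLanguage_nil, Language.mem_one] at hw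
    subst hw
    exact Derives.refl _
  | cons x u ih =>
    rw [formLanguage_cons, Language.mem_mul] at hw
    obtain ⟨a, ha, b, hb, rfl⟩ := hw
    have hx : g.Derives [x] (a.map Symbol.terminal) := by
      cases x with
      | terminal c =>
        obtain rfl : a = [c] := ha
        exact Derives.refl _
      | nonterminal n => exact ha
    rw [List.map_append]
    exact (hx.append_right u).trans ((ih hb).append_left _)

theorem isClosedFamily_languageFrom :
    IsClosedFamily (g.rules : Set (ContextFreeRule T g.NT)) g.languageFrom := fun r hr _ hw =>
  Produces.trans_derives ⟨r, hr, Rewrites.input_output⟩ (g.derives_of_mem_formLanguage hw)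

/-- Each derivation step can only shrink the denoted language, and a terminal word denotes its own
singleton. -/
theorem languageFrom_le {K : g.NT → Language T}
    (hK : IsClosedFamily (g.rules : Set (ContextFreeRule T g.NT)) K) (n : g.NT) :
    g.languageFrom n ≤ K n := by
  have hmono {u v : List (Symbol T g.NT)} (huv : g.Derives u v) :
      formLanguage K v ≤ formLanguage K u := by
    induction huv with
    | refl => exact le_rfl
    | tail _ hstep ih =>
      obtain ⟨r, hr, hrw⟩ := hstep
      exact (hrw.formLanguage_le (hK r hr)).trans ih
  intro w hw
  have := hmono hw
  rw [formLanguage_map_terminal, formLanguage_cons, formLanguage_nil, mul_one] at this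
  exact this rfl

end ContextFreeGrammar

open ContextFreeRule in
/-- A component of the least family closed under finitely many rules is context-free. -/
theorem Language.isContextFree_of_isClosedFamily {T N : Type*} [Finite N]
    {R : Set (ContextFreeRule T N)} (hR : R.Finite) (n : N) {L : Language T}
    {K : N → Language T} (hK : IsClosedFamily R K) (hKL : K n ≤ L)
    (hL : ∀ M : N → Language T, IsClosedFamily R M → L ≤ M n) : L.IsContextFree := by
  -- Renaming along `e` moves the nonterminals from an arbitrary universe into `Type`.
  obtain ⟨k, ⟨e⟩⟩ := Finite.exists_equiv_fin N
  let g : ContextFreeGrammar T := ⟨Fin k, e n, (hR.image (mapNonterminal e)).toFinset⟩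
  have hrules {r : ContextFreeRule T (Fin k)} :
      r ∈ (g.rules : Set (ContextFreeRule T (Fin k))) ↔ r ∈ mapNonterminal e '' R := by
    simp [g]
  refine ⟨g, le_antisymm (le_trans ?_ hKL) (hL (g.languageFrom ∘ e) fun r hr => ?_)⟩
  · have hclosed : IsClosedFamily (g.rules : Set (ContextFreeRule T (Fin k))) (K ∘ e.symm) := by
      intro r hr
      obtain ⟨r', hr', rfl⟩ := hrules.1 hr
      rw [formLanguage_mapNonterminal, Function.comp_assoc, Equiv.symm_comp_self]
      simpa [mapNonterminal] using hK r' hr'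
    exact (g.languageFrom_le hclosed (e n)).trans (by simp)
  · rw [← formLanguage_mapNonterminal]
    exact g.isClosedFamily_languageFrom _ (hrules.2 ⟨r, hr, rfl⟩)

/-! ### The grammar of an automaton and its soundness -/

namespace NPDA

open ContextFreeRule

variable {A S Γ : Type*} (P : NPDA A S Γ)

theorem Path.trans {P : NPDA A S Γ} {s₁ s₂ s₃ : S} {st₁ st₂ st₃ : List Γ} {u v : List A}
    (h : P.Path s₁ st₁ u s₂ st₂) (h' : P.Path s₂ st₂ v s₃ st₃) :
    P.Path s₁ st₁ (u ++ v) s₃ st₃ := by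
  induction h with
  | refl => exact h'
  | step htrans hstack _ ih =>
    rw [List.append_assoc]
    exact .step htrans hstack (ih h')

/-- The nonterminals of the grammar of an automaton. The triple `(p, t, some r)` stands for the
computations that start in state `p` with top of stack `t`, never touch the initial stack, and end
in state `r` with the initial stack; `(p, t, none)` stands for those that start likewise, never
touch the initial stack, and end in an accepting situation. -/
abbrev Goal (S Γ : Type*) := S × Option Γ × Option S

/-- The terminals read by a transition. -/
def inputForm (a : Option A) : List (Symbol A (Goal S Γ)) := a.toList.map Symbol.terminal

/-- The rules of the grammar of an automaton. -/
inductive IsRule : Goal S Γ → List (Symbol A (Goal S Γ)) → Prop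
  | refl (p : S) (t : Option Γ) : IsRule (p, t, some p) []
  | accept {p : S} {t : Option Γ} (h : (p, t) ∈ P.accept) : IsRule (p, t, none) []
  | doNothing {p q : S} {t : Option Γ} {a : Option A} (r : Option S)
      (h : (q, .doNothing) ∈ P.δ p t a) :
      IsRule (p, t, r) (inputForm a ++ [.nonterminal (q, t, r)])
  | pushPop {p q q' p' : S} {t : Option Γ} {γ : Γ} {a b : Option A} (r : Option S)
      (h : (q, .push γ) ∈ P.δ p t a) (h' : (p', .pop) ∈ P.δ q' (some γ) b) :
      IsRule (p, t, r) (inputForm a ++ .nonterminal (q, some γ, some q') ::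
        (inputForm b ++ [.nonterminal (p', t, r)]))
  | pushKeep {p q : S} {t : Option Γ} {γ : Γ} {a : Option A} (h : (q, .push γ) ∈ P.δ p t a) :
      IsRule (p, t, none) (inputForm a ++ [.nonterminal (q, some γ, none)])

/-- The set of rules of the grammar of an automaton. -/
def rules : Set (ContextFreeRule A (Goal S Γ)) := {r | P.IsRule r.input r.output}

theorem length_inputForm_le (a : Option A) :
    (inputForm a : List (Symbol A (Goal S Γ))).length ≤ 1 := by
  cases a <;> simp [inputForm]

/-- The extreme case is `pushPop`: two nonterminals and at most two letters. -/
theorem IsRule.length_le {P : NPDA A S Γ} {n : Goal S Γ} {u : List (Symbol A (Goal S Γ))}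
    (h : P.IsRule n u) : u.length ≤ 4 := by
  cases h with
  | refl | accept => simp
  | @doNothing _ _ _ a | @pushKeep _ _ _ _ a =>
    have := length_inputForm_le (S := S) (Γ := Γ) a
    simp only [List.length_append, List.length_singleton]
    omega
  | @pushPop _ _ _ _ _ _ a b =>
    have := length_inputForm_le (S := S) (Γ := Γ) a
    have := length_inputForm_le (S := S) (Γ := Γ) b
    simp only [List.length_append, List.length_cons, List.length_nil]
    omega

theorem finite_rules [Finite A] [Finite S] [Finite Γ] : P.rules.Finite := by
  have : Finite (Symbol A (Goal S Γ)) := by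
    cases nonempty_fintype A
    cases nonempty_fintype (Goal S Γ)
    infer_instance
  refine (((Set.finite_univ (α := Goal S Γ)).prod
    (List.finite_length_le (Symbol A (Goal S Γ)) 4)).image fun x => ⟨x.1, x.2⟩).subset ?_
  exact fun r hr => ⟨(r.input, r.output), ⟨trivial, IsRule.length_le hr⟩, rfl⟩

@[simp] theorem formLanguage_inputForm (K : Goal S Γ → Language A) (a : Option A) :
    formLanguage K (inputForm a) = {a.toList} :=
  formLanguage_map_terminal K _

/-- The words read by the computations that a goal stands for. -/
def goalLanguage : Goal S Γ → Language A
  | (p, t, some r) => {w | ∀ st : List Γ, st.head? = t → P.Path p st w r st}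
  | (p, t, none) => {w | ∀ st : List Γ, st.head? = t →
      ∃ (s : S) (st' : List Γ), P.Path p st w s st' ∧ (s, st'.head?) ∈ P.accept}

theorem mem_goalLanguage_of_forall_path {P : NPDA A S Γ} {p q : S} {t t' : Option Γ} {u v : List A}
    {r : Option S}
    (h : ∀ st : List Γ, st.head? = t → st.head? = t' ∧ P.Path p st u q st)
    (hv : v ∈ P.goalLanguage (q, t', r)) : u ++ v ∈ P.goalLanguage (p, t, r) := by
  cases r with
  | some r => exact fun st hst => (h st hst).2.trans (hv st (h st hst).1)
  | none =>
    intro st hst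
    obtain ⟨s, st', hpath, hacc⟩ := hv st (h st hst).1
    exact ⟨s, st', (h st hst).2.trans hpath, hacc⟩

theorem isClosedFamily_goalLanguage : IsClosedFamily P.rules P.goalLanguage := by
  rintro ⟨n, u⟩ (h : P.IsRule n u)
  intro w hw
  change w ∈ formLanguage P.goalLanguage u at hw
  change w ∈ P.goalLanguage n
  cases h with
  | refl p t =>
    obtain rfl : w = [] := hw
    exact fun st _ => .refl _ _
  | accept h =>
    obtain rfl : w = [] := hw
    exact fun st hst => ⟨_, st, .refl _ _, hst ▸ h⟩
  | doNothing r h =>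
    simp only [formLanguage_append, formLanguage_inputForm, formLanguage_cons,
      formLanguage_nil, mul_one, Language.mem_mul] at hw
    obtain ⟨_, rfl, v, hv, rfl⟩ := hw
    refine mem_goalLanguage_of_forall_path (fun st hst => ⟨hst, ?_⟩) hv
    simpa using Path.step (hst ▸ h) rfl (.refl _ _)
  | pushPop r h h' =>
    simp only [formLanguage_append, formLanguage_inputForm, formLanguage_cons,
      formLanguage_nil, mul_one, Language.mem_mul] at hw
    obtain ⟨_, rfl, _, ⟨u, hu, _, ⟨_, rfl, v, hv, rfl⟩, rfl⟩, rfl⟩ := hw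
    rw [← List.append_assoc, ← List.append_assoc]
    refine mem_goalLanguage_of_forall_path (fun st hst => ⟨hst, ?_⟩) hv
    rw [List.append_assoc]
    -- The inner computation runs on `γ :: st` and restores it, so the pop gives back `st`.
    refine .step (hst ▸ h) rfl ((hu _ rfl).trans ?_)
    simpa using Path.step (st₁ := _ :: st) h' rfl (.refl _ _)
  | pushKeep h =>
    simp only [formLanguage_append, formLanguage_inputForm, formLanguage_cons,
      formLanguage_nil, mul_one, Language.mem_mul] at hw
    obtain ⟨_, rfl, v, hv, rfl⟩ := hw
    intro st hst
    obtain ⟨s, st', hpath, hacc⟩ := hv (_ :: st) rfl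
    exact ⟨s, st', .step (hst ▸ h) rfl hpath, hacc⟩

/-! ### Completeness: cutting computations at pops -/

/-- An accepting computation from a given state and stack, cut at the moments at which the
symbols of the initial stack are popped; its pieces are words of the languages `M`. -/
inductive Cut (M : Goal S Γ → Language A) : S → List Γ → List A → Prop
  | keep {p : S} {st : List Γ} {w : List A} (h : w ∈ M (p, st.head?, none)) : Cut M p st w
  | pop {p q p' : S} {γ : Γ} {st : List Γ} {u v : List A} {a : Option A}
      (hu : u ∈ M (p, some γ, some q)) (h : (p', .pop) ∈ P.δ q (some γ) a) (hv : Cut M p' st v) :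
      Cut M p (γ :: st) (u ++ (a.toList ++ v))

section Cut

variable {P} {M : Goal S Γ → Language A} (hM : IsClosedFamily P.rules M)
include hM

theorem IsRule.mem {n : Goal S Γ} {u : List (Symbol A (Goal S Γ))} (h : P.IsRule n u) {w : List A}
    (hw : w ∈ formLanguage M u) : w ∈ M n :=
  hM ⟨n, u⟩ h hw

theorem mem_of_doNothing {p q : S} {t : Option Γ} {a : Option A} {r : Option S} {v : List A}
    (h : (q, .doNothing) ∈ P.δ p t a) (hv : v ∈ M (q, t, r)) : a.toList ++ v ∈ M (p, t, r) := by
  refine (IsRule.doNothing r h).mem hM ?_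
  simp only [formLanguage_append, formLanguage_inputForm, formLanguage_cons,
    formLanguage_nil, mul_one]
  exact Language.append_mem_mul rfl hv

theorem mem_of_push {p q : S} {t : Option Γ} {γ : Γ} {a : Option A} {v : List A}
    (h : (q, .push γ) ∈ P.δ p t a) (hv : v ∈ M (q, some γ, none)) :
    a.toList ++ v ∈ M (p, t, none) := by
  refine (IsRule.pushKeep h).mem hM ?_
  simp only [formLanguage_append, formLanguage_inputForm, formLanguage_cons,
    formLanguage_nil, mul_one]
  exact Language.append_mem_mul rfl hv

theorem mem_of_push_of_pop {p q q' p' : S} {t : Option Γ} {γ : Γ} {a b : Option A} {r : Option S}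
    {u v : List A} (h : (q, .push γ) ∈ P.δ p t a) (hu : u ∈ M (q, some γ, some q'))
    (h' : (p', .pop) ∈ P.δ q' (some γ) b) (hv : v ∈ M (p', t, r)) :
    a.toList ++ (u ++ (b.toList ++ v)) ∈ M (p, t, r) := by
  refine (IsRule.pushPop r h h').mem hM ?_
  simp only [formLanguage_append, formLanguage_inputForm, formLanguage_cons,
    formLanguage_nil, mul_one]
  exact Language.append_mem_mul rfl
    (Language.append_mem_mul hu (Language.append_mem_mul rfl hv))

/-- Prepending a transition lengthens the first piece, adds an empty piece (pop), or, after a push,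
may fuse the first two pieces. -/
theorem Cut.step {p q : S} {st st' : List Γ} {a : Option A} {act : StackAction Γ} {w : List A}
    (htrans : (q, act) ∈ P.δ p st.head? a) (hstack : act.apply st = some st')
    (hw : P.Cut M q st' w) : P.Cut M p st (a.toList ++ w) := by
  cases act with
  | doNothing =>
    obtain rfl : st = st' := by simpa [StackAction.apply] using hstack
    cases hw with
    | keep h => exact .keep (mem_of_doNothing hM htrans h)
    | pop hu h hv =>
      rw [← List.append_assoc]
      exact .pop (mem_of_doNothing hM htrans hu) h hv
  | pop =>
    cases st with
    | nil => simp [StackAction.apply] at hstack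
    | cons γ st =>
      obtain rfl : st = st' := by simpa [StackAction.apply] using hstack
      -- The top symbol is popped at once, so its piece is the empty word.
      exact .pop (u := []) ((IsRule.refl p (some γ)).mem hM rfl) htrans hw
  | push γ =>
    obtain rfl : γ :: st = st' := by simpa [StackAction.apply] using hstack
    cases hw with
    | keep h => exact .keep (mem_of_push hM htrans h)
    | pop hu h hv =>
      -- The pushed symbol is popped later: its piece and the next one merge by `pushPop`, with `r`
      -- the goal of the latter.
      cases hv with
      | keep hv => exact .keep (mem_of_push_of_pop hM htrans hu h hv)
      | pop hu' h' hv' =>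
        have := Cut.pop (mem_of_push_of_pop hM htrans hu h hu') h' hv'
        simpa only [List.append_assoc] using this

theorem Path.cut {p s : S} {st st' : List Γ} {w : List A} (h : P.Path p st w s st')
    (hacc : (s, st'.head?) ∈ P.accept) : P.Cut M p st w := by
  induction h with
  | refl => exact .keep ((IsRule.accept hacc).mem hM rfl)
  | step htrans hstack _ ih => exact Cut.step hM htrans hstack (ih hacc)

theorem language_le : P.language ≤ M (P.start, none, none) := by
  rintro w ⟨s, st, hpath, hacc⟩
  -- `Cut.pop` needs a nonempty initial stack, so only `keep` remains.
  cases hpath.cut hM hacc with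
  | keep h => exact h

end Cut

end NPDA

theorem mainTheorem7 {A S Γ : Type*} [Finite A] [Finite S] [Finite Γ]
    (L : Language A) (P : NPDA A S Γ) (hL : P.language = L) :
    L.IsContextFree := by
  subst hL
  exact Language.isContextFree_of_isClosedFamily P.finite_rules (P.start, none, none)
    P.isClosedFamily_goalLanguage (fun _ hw => hw [] rfl) fun _ hM => NPDA.language_le hM
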